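/- Let $F$ be a (not necessarily unital) C$^*$-algebra. Equip the bidual $F''$ with the Arens product and the canonical involution $\langle \Phi^*, f\rangle = \overline{\langle \Phi, f^*\rangle}$, where $f^*(x)=\overline{f(x^*)}$ (so that $F''$ is the enveloping von Neumann algebra of $F$). Suppose that the Banach space $\mathcal A = F'$ carries a product making it a Banach algebra, and consider $\mathcal A' = F''$ as an $\mathcal A$-bimodule by $\langle a\cdot\mu, b\rangle = \langle \mu, ba\rangle$ and $\langle \mu\cdot a, b\rangle = \langle\mu, ab\rangle$. For a closed subspace $E\subseteq \mathcal A'$ let $\iota_E:\mathcal A\to E'$ be the canonical map $\iota_E(a)(x) = x(a)$, i.e. the composition of $\mathcal A\to\mathcal A''$ with the quotient map $\mathcal A''\to\mathcal A''/E^\perp = E'$. Such an $E$ is called a predual of $\mathcal A$ if it is a closed $\mathcal A$-submodule of $\mathcal A'$ and $\iota_E$ is an isomorphism of Banach spaces (not assumed isometric), and an isometric predual if moreover $\iota_E$ is isometric. Let $E\subseteq F''$ be a predual of $\mathcal A$ that is also a C$^*$-subalgebra of $F''$, and equip $E''$ with its Arens product and canonical involution. Then: 1. The adjoint $\iota_E':E''\to\mathcal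 A' = F''$ is a $^*$-isomorphism. Moreover $\iota_E$ and $\iota_E'$ are isometric; in particular $E$ is an isometric predual of $\mathcal A$. 2. For every $m\in E'$, with $a = \iota_E^{-1}(m)\in F'$: (i) $a$ is positive on $F$ if and only if $m$ is positive on $E$; (ii) $a$ is a state on $F$ if and only if $m$ is a state on $E$; (iii) $a$ is a pure state on $F$ if and only if $m$ is a pure state on $E$. Here a functional $f$ is positive if $f(x^*x)\ge 0$ for all $x$, a state is a positive functional of norm one, and a pure state is an extreme point of the set of states. -/

import Mathlib

open scoped ComplexOrder

noncomputable section

/-! ### Normed algebras with an isometric involution -/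

/-- Normed complex algebras with an isometric, conjugate-linear, involutive map `star`. This only
bundles the standard type classes on which the constructions below depend; C*-algebras, their
biduals and the star-subalgebras of these biduals are instances. -/
class StarNormedAlgebra (X : Type*) extends NonUnitalNormedRing X, NormedSpace ℂ X,
  IsScalarTower ℂ X X, SMulCommClass ℂ X X, StarAddMonoid X, StarModule ℂ X, NormedStarGroup X

/-- Every C*-algebra. -/
instance (priority := 50) NonUnitalCStarAlgebra.toStarNormedAlgebra (X : Type*)
    [NonUnitalCStarAlgebra X] : StarNormedAlgebra X where

/-- The bidual `X''` of `X`, as a Banach space. -/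
abbrev Bidual (X : Type*) [StarNormedAlgebra X] : Type _ := StrongDual ℂ (StrongDual ℂ X)

/-! ### The Arens product on the bidual of a normed algebra -/

namespace ArensBidual

section Product

variable {X : Type*} [NonUnitalNormedRing X] [NormedSpace ℂ X]
  [IsScalarTower ℂ X X] [SMulCommClass ℂ X X]

/-- The action of `Ψ ∈ X''` on the dual `X'`: the functional `Ψ · f` is `a ↦ Ψ (f · a)`, where
`f · a` is `b ↦ f (a * b)`. -/
def act (Ψ : StrongDual ℂ (StrongDual ℂ X)) : StrongDual ℂ X →L[ℂ] StrongDual ℂ X :=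
  (ContinuousLinearMap.compL ℂ X (StrongDual ℂ X) ℂ Ψ) ∘L
    ((ContinuousLinearMap.compL ℂ X (X →L[ℂ] X) (StrongDual ℂ X)).flip
      (ContinuousLinearMap.mul ℂ X)) ∘L
    (ContinuousLinearMap.compL ℂ X X ℂ)

theorem act_apply (Ψ : StrongDual ℂ (StrongDual ℂ X)) (f : StrongDual ℂ X) (a : X) :
    act Ψ f a = Ψ (f ∘L ContinuousLinearMap.mul ℂ X a) := rfl

/-- The (first) Arens product on the bidual `X''`: `(Φ * Ψ) f = Φ (Ψ · f)`. -/
instance instMul : Mul (StrongDual ℂ (StrongDual ℂ X)) where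
  mul Φ Ψ := Φ ∘L act Ψ

theorem mul_apply (Φ Ψ : StrongDual ℂ (StrongDual ℂ X)) (f : StrongDual ℂ X) :
    (Φ * Ψ) f = Φ (act Ψ f) := rfl

theorem norm_act_le (Ψ : StrongDual ℂ (StrongDual ℂ X)) (f : StrongDual ℂ X) :
    ‖act Ψ f‖ ≤ ‖Ψ‖ * ‖f‖ := by
  refine ContinuousLinearMap.opNorm_le_bound _ (by positivity) fun a => ?_
  rw [act_apply]
  calc ‖Ψ (f ∘L ContinuousLinearMap.mul ℂ X a)‖
      ≤ ‖Ψ‖ * ‖f ∘L ContinuousLinearMap.mul ℂ X a‖ := Ψ.le_opNorm _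
    _ ≤ ‖Ψ‖ * (‖f‖ * ‖ContinuousLinearMap.mul ℂ X a‖) := by
        gcongr; exact ContinuousLinearMap.opNorm_comp_le _ _
    _ ≤ ‖Ψ‖ * (‖f‖ * ‖a‖) := by
        gcongr; exact ContinuousLinearMap.opNorm_mul_apply_le ℂ X a
    _ = ‖Ψ‖ * ‖f‖ * ‖a‖ := by ring

theorem act_mul (Φ Ψ : StrongDual ℂ (StrongDual ℂ X)) (f : StrongDual ℂ X) :
    act (Φ * Ψ) f = act Φ (act Ψ f) := by
  ext a
  rw [act_apply, mul_apply, act_apply]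
  congr 1
  ext b
  simp only [act_apply, ContinuousLinearMap.comp_apply, ContinuousLinearMap.mul_apply']
  congr 1
  ext c
  simp [mul_assoc]

/-- The bidual of a normed algebra, with the Arens product and its usual norm, is a normed
algebra. -/
instance instNonUnitalNormedRing : NonUnitalNormedRing (StrongDual ℂ (StrongDual ℂ X)) where
  left_distrib Φ Ψ Θ := by
    ext f
    simp only [mul_apply, add_apply, ← map_add]
    rfl
  right_distrib Φ Ψ Θ := by
    ext f
    rfl
  zero_mul Φ := by
    ext f
    rfl
  mul_zero Φ := by
    ext f
    exact map_zero Φ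
  mul_assoc Φ Ψ Θ := by
    ext f
    simp only [mul_apply, act_mul]
  dist_eq := NormedAddCommGroup.dist_eq
  norm_mul_le Φ Ψ := by
    refine ContinuousLinearMap.opNorm_le_bound _ (by positivity) fun f => ?_
    calc ‖(Φ * Ψ) f‖ ≤ ‖Φ‖ * ‖act Ψ f‖ := Φ.le_opNorm _
      _ ≤ ‖Φ‖ * (‖Ψ‖ * ‖f‖) := by gcongr; exact norm_act_le Ψ f
      _ = ‖Φ‖ * ‖Ψ‖ * ‖f‖ := by ring

instance instIsScalarTower : IsScalarTower ℂ (StrongDual ℂ (StrongDual ℂ X))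
    (StrongDual ℂ (StrongDual ℂ X)) where
  smul_assoc c Φ Ψ := by
    ext f
    rfl

instance instSMulCommClass : SMulCommClass ℂ (StrongDual ℂ (StrongDual ℂ X))
    (StrongDual ℂ (StrongDual ℂ X)) where
  smul_comm c Φ Ψ := by
    ext f
    exact (map_smul Φ c (act Ψ f)).symm

end Product

/-! ### The involution on the dual and the bidual -/

section Star

variable {X : Type*} [NormedAddCommGroup X] [NormedSpace ℂ X] [StarAddMonoid X]
  [StarModule ℂ X] [NormedStarGroup X]

/-- The adjoint functional `f* : x ↦ conj (f (x*))` of a functional `f` on a space with an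
isometric conjugate-linear involution. Applied twice, this gives the involution on the bidual. -/
instance instStarDual : Star (StrongDual ℂ X) where
  star f := LinearMap.mkContinuous
    { toFun := fun x => star (f (star x))
      map_add' := fun x y => by simp
      map_smul' := fun c x => by simp [star_smul] } ‖f‖ fun x => by
        simpa using f.le_opNorm (star x)

theorem star_apply (f : StrongDual ℂ X) (x : X) : (star f) x = star (f (star x)) := rfl

instance instStarAddMonoidDual : StarAddMonoid (StrongDual ℂ X) where
  star_involutive f := by
    ext x
    simp [star_apply]
  star_add f g := by
    ext x
    simp [star_apply]

instance instStarModuleDual : StarModule ℂ (StrongDual ℂ X) where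
  star_smul c f := by
    ext x
    simp [star_apply]

instance instNormedStarGroupDual : NormedStarGroup (StrongDual ℂ X) where
  norm_star_le f := ContinuousLinearMap.opNorm_le_bound _ (by positivity) fun x => by
    rw [star_apply, norm_star]
    simpa using f.le_opNorm (star x)

end Star

/-- The bidual with the Arens product and the double adjoint involution. -/
instance instStarNormedAlgebraBidual {X : Type*} [StarNormedAlgebra X] :
    StarNormedAlgebra (Bidual X) where

/-- Star-subalgebras, with the restricted structure. -/
instance instStarNormedAlgebraSub {X : Type*} [StarNormedAlgebra X]
    (E : NonUnitalStarSubalgebra ℂ (Bidual X)) : StarNormedAlgebra E where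
  __ := (inferInstance : NonUnitalNormedRing E)
  __ := (inferInstance : NormedSpace ℂ E)
  __ := (inferInstance : StarAddMonoid E)
  smul_assoc c x y := smul_assoc c x y
  smul_comm c x y := smul_comm c x y
  star_smul c x := star_smul c x
  norm_star_le x := (norm_star (x : Bidual X)).le

end ArensBidual

/-! ### Preduals -/

section Predual

variable {A : Type*} [NormedAddCommGroup A] [NormedSpace ℂ A]

/-- A bounded bilinear map which makes the Banach space `A` a Banach algebra. -/
structure IsBanachAlgebraMul (mul : A →L[ℂ] A →L[ℂ] A) : Prop where
  assoc : ∀ a b c, mul (mul a b) c = mul a (mul b c)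
  norm_mul_le : ∀ a b, ‖mul a b‖ ≤ ‖a‖ * ‖b‖

variable {S : Type*} [SetLike S (StrongDual ℂ A)] [AddSubgroupClass S (StrongDual ℂ A)]
  [SMulMemClass S ℂ (StrongDual ℂ A)]

/-- The canonical map `ι_E : A → E'` for a subspace `E` of the dual `A'`, i.e. the canonical
embedding `A → A''` followed by the quotient map `A'' → A'' / E^⊥ = E'`, which is the restriction
of functionals to `E`. Thus `ι_E a` is the functional `x ↦ x a` on `E`. -/
def iota (E : S) : A →L[ℂ] StrongDual ℂ E :=
  (ContinuousLinearMap.precomp ℂ (⟨SMulMemClass.subtype E, continuous_subtype_val⟩ :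
    E →L[ℂ] StrongDual ℂ A)) ∘L
    (NormedSpace.inclusionInDoubleDual ℂ A)

theorem iota_apply (E : S) (a : A) (x : E) : iota E a x = (x : StrongDual ℂ A) a := rfl

/-- `E ⊆ A'` is a predual of the Banach algebra `A` (with product `mul`): a closed
`A`-submodule of `A'`, for the actions `(a · μ)(b) = μ (b a)` and `(μ · a)(b) = μ (a b)`,
such that `ι_E : A → E'` is an isomorphism of Banach spaces. -/
structure IsPredual (mul : A →L[ℂ] A →L[ℂ] A) (E : S) : Prop where
  isClosed : IsClosed (E : Set (StrongDual ℂ A))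
  left_mem : ∀ (a : A), ∀ μ ∈ E, μ ∘L mul.flip a ∈ E
  right_mem : ∀ (a : A), ∀ μ ∈ E, μ ∘L mul a ∈ E
  isInvertible : (iota E).IsInvertible

/-- An isometric predual is a predual for which `ι_E` is isometric. -/
structure IsIsometricPredual (mul : A →L[ℂ] A →L[ℂ] A) (E : S) : Prop
    extends IsPredual mul E where
  isometry : Isometry (iota E)

end Predual

/-! ### Positive functionals, states, pure states -/

section States

variable {X : Type*} [StarNormedAlgebra X]

/-- A functional is positive if `0 ≤ f (x* x)` for all `x`. -/
def IsPositiveFunctional (f : StrongDual ℂ X) : Prop := ∀ x : X, 0 ≤ f (star x * x)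

variable (X) in
/-- The states: positive functionals of norm one. -/
def stateSpace : Set (StrongDual ℂ X) := {f | IsPositiveFunctional f ∧ ‖f‖ = 1}

/-- The states, as a predicate. -/
def IsStateFunctional (f : StrongDual ℂ X) : Prop := f ∈ stateSpace X

/-- The pure states: extreme points of the state space. -/
def IsPureStateFunctional (f : StrongDual ℂ X) : Prop := f ∈ (stateSpace X).extremePoints ℝ

end States

end

/-! The adjoint `ι_E'` is bijective because `ι_E` is invertible, so the point is that it is a star
homomorphism between C*-algebras: such a bijection is automatically isometric, and duality transfers
this to `ι_E`.

This rests on three facts about a C*-algebra `X`: the Arens product on `X''` is regular, the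
canonical involution reverses it, and the C*-identity holds. All three follow by writing each
functional as `f x = ⟪ζ, j x⟫`, with `j` the GNS map of a positive `φ` satisfying `‖φ‖ ≤ 1` and `‖ζ‖
≤ ‖f‖`. Since a Hilbert space is reflexive, each `Φ` in `X''` acts on such functionals through a
single vector `η`, and `(Φ* Φ) φ = ‖η‖²`. The dominating `φ` comes from a Hahn–Banach separation.

The facts apply to `F` and also to `E`, a closed star-subalgebra of `F''`. Positivity passes to the
bidual by the formula for `(Φ* Φ) φ`, hence moves between `F` and `E`; states and their extreme
points follow. -/

section Domination

/-! ### Domination of functionals by positive functionals. -/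

variable {X : Type*} [NonUnitalCStarAlgebra X]

/-- A contractive functional `f` on a C*-algebra satisfies `2 Re f(x) - 1 ≤ g(x* x)` for some
contractive real functional `g`. -/
theorem exists_real_dominating (f : StrongDual ℂ X) (hf : ‖f‖ ≤ 1) :
    ∃ g : X →L[ℝ] ℝ, (∀ h, g h ≤ ‖h‖) ∧ ∀ x, 2 * (f x).re - 1 ≤ g (star x * x) := by
  let _ : PartialOrder X := CStarAlgebra.spectralOrder X
  have _ : StarOrderedRing X := CStarAlgebra.spectralOrderedRing X
  -- The strict epigraph of the norm misses `t` because `2 ‖x‖ - 1 ≤ ‖x‖² = ‖star x * x‖`. The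
  -- affine bound `2 Re f - 1` stands in for `|f|²`, which would not make `t` convex.
  let s : Set (X × ℝ) := {p | ‖p.1‖ < p.2}
  let t : Set (X × ℝ) := {p | ∃ x, star x * x ≤ p.1 ∧ p.2 ≤ 2 * (f x).re - 1}
  have hs : Convex ℝ s := by
    intro p hp q hq a b ha hb hab
    have h1 : ‖a • p.1 + b • q.1‖ ≤ a * ‖p.1‖ + b * ‖q.1‖ := by
      refine (norm_add_le _ _).trans_eq ?_
      rw [norm_smul, norm_smul, Real.norm_of_nonneg ha, Real.norm_of_nonneg hb]
    change ‖a • p.1 + b • q.1‖ < a * p.2 + b * q.2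
    refine h1.trans_lt ?_
    simp only [s, Set.mem_ofPred_eq] at hp hq
    rcases ha.eq_or_lt with rfl | ha'
    · have : b = 1 := by linarith
      subst this; simpa using hq
    · nlinarith
  have hso : IsOpen s := isOpen_lt (continuous_fst.norm) continuous_snd
  have ht : Convex ℝ t := by
    rintro p ⟨x, hx, hx'⟩ q ⟨y, hy, hy'⟩ a b ha hb hab
    refine ⟨a • x + b • y, ?_, ?_⟩
    -- Operator convexity of `x ↦ star x * x`, with its explicit defect.
    · have key : star (a • x + b • y) * (a • x + b • y) + (a * b) • (star (x - y) * (x - y))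
          = a • (star x * x) + b • (star y * y) := by
        obtain rfl : b = 1 - a := by linarith
        simp only [star_add, star_smul, star_trivial, star_sub, mul_add, add_mul, mul_sub, sub_mul,
          smul_mul_assoc, mul_smul_comm, smul_sub, smul_add]
        module
      have h0 : 0 ≤ (a * b) • (star (x - y) * (x - y)) :=
        smul_nonneg (by positivity) (star_mul_self_nonneg _)
      calc star (a • x + b • y) * (a • x + b • y)
          ≤ star (a • x + b • y) * (a • x + b • y) + (a * b) • (star (x - y) * (x - y)) :=
            le_add_of_nonneg_right h0
        _ = a • (star x * x) + b • (star y * y) := key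
        _ ≤ a • p.1 + b • q.1 := add_le_add (smul_le_smul_of_nonneg_left hx ha)
            (smul_le_smul_of_nonneg_left hy hb)
    · have : (f (a • x + b • y)).re = a * (f x).re + b * (f y).re := by
        rw [map_add, ← Complex.coe_smul, ← Complex.coe_smul, map_smul, map_smul]
        simp
      change a * p.2 + b * q.2 ≤ _
      rw [this]
      nlinarith
  have hd : Disjoint s t := by
    rw [Set.disjoint_left]
    rintro p hp ⟨x, hx, hx'⟩
    have h1 : ‖star x * x‖ ≤ ‖p.1‖ :=
      CStarAlgebra.norm_le_norm_of_nonneg_of_le (star_mul_self_nonneg x) hx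
    rw [CStarRing.norm_star_mul_self] at h1
    have h2 : (f x).re ≤ ‖x‖ := (Complex.re_le_norm _).trans (by
      simpa using f.le_of_opNorm_le hf x)
    simp only [s, Set.mem_ofPred_eq] at hp
    nlinarith [sq_nonneg (‖x‖ - 1)]
  obtain ⟨g, u, hgs, hgt⟩ := geometric_hahn_banach_open hs hso ht hd
  have hdec : ∀ h r, g (h, r) = g (h, 0) + r * g (0, 1) := fun h r => by
    rw [← smul_eq_mul, ← map_smul, ← map_add]; simp
  set c := g (0, 1) with hc_def
  -- `s` is a cone, so the separating level may be taken to be `0`.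
  have hscale : ∀ p ∈ s, ∀ k : ℝ, 0 < k → k * g p < u := fun p hp k hk => by
    have : k • p ∈ s := by
      change ‖k • p.1‖ < k * p.2
      rw [norm_smul, Real.norm_of_nonneg hk.le]
      exact mul_lt_mul_of_pos_left hp hk
    simpa using hgs _ this
  have hs0 : ((0, 1) : X × ℝ) ∈ s := by simp [s]
  have hu : 0 ≤ u := by
    by_contra! h
    have hc : c < u := hgs _ hs0
    have h1 := hscale _ hs0 (u / (2 * c)) (div_pos_of_neg_of_neg h (by linarith))
    have h2 : u / (2 * c) * c = u / 2 := by
      field_simp [(hc.trans h).ne]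
    rw [← hc_def, h2] at h1
    have h3 := hscale _ hs0 1 one_pos
    linarith
  have hneg : ∀ p ∈ s, g p ≤ 0 := fun p hp => by
    by_contra! h
    have h1 := hscale p hp (u / g p + 1) (by positivity)
    have h2 : (u / g p + 1) * g p = u + g p := by field_simp
    linarith
  -- The point of `t` given by `x = 0` excludes a vertical hyperplane, so dividing by `-c` is
  -- possible.
  have hc : c < 0 := by
    have h1 := hgt (0, -1) ⟨0, by simp, by simp⟩
    rw [hdec, show ((0, 0) : X × ℝ) = 0 from rfl, map_zero] at h1
    have h2 : c < u := hgs _ hs0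
    linarith
  refine ⟨(-c)⁻¹ • (g ∘L ContinuousLinearMap.inl ℝ X ℝ), fun h => ?_, fun x => ?_⟩
  · refine le_of_forall_gt_imp_ge_of_dense fun r hr => ?_
    have h1 := hneg (h, r) hr
    rw [hdec] at h1
    change (-c)⁻¹ * g (h, 0) ≤ r
    rw [inv_mul_eq_div, div_le_iff₀ (by linarith)]
    linarith
  · have h1 := hu.trans (hgt (star x * x, 2 * (f x).re - 1) ⟨x, le_rfl, le_rfl⟩)
    rw [hdec] at h1
    change _ ≤ (-c)⁻¹ * g (star x * x, 0)
    rw [inv_mul_eq_div, le_div_iff₀ (by linarith)]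
    linarith

/-- Every contractive functional `f` on a C*-algebra is dominated by a contractive positive
functional `φ`, in the sense that `|f x|² ≤ φ (x* x)`. -/
theorem exists_positive_dominating (f : StrongDual ℂ X) (hf : ‖f‖ ≤ 1) :
    ∃ φ : StrongDual ℂ X, ‖φ‖ ≤ 1 ∧ IsPositiveFunctional φ ∧
      ∀ x, ‖f x‖ ^ 2 ≤ (φ (star x * x)).re := by
  obtain ⟨g, hg, hfg⟩ := exists_real_dominating f hf
  let ψ : StrongDual ℂ X := StrongDual.extendRCLike g
  have hψre : ∀ x, (ψ x).re = g x := fun x => by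
    simp [ψ, StrongDual.extendRCLike_apply]
  have hψ : ‖ψ‖ ≤ 1 := by
    rw [StrongDual.norm_extendRCLike]
    refine g.opNorm_le_bound zero_le_one fun x => ?_
    rw [one_mul, Real.norm_eq_abs, abs_le]
    have := hg (-x)
    rw [map_neg, norm_neg] at this
    exact ⟨by linarith, hg x⟩
  -- `ψ` need not be hermitian; symmetrising it leaves its real part on the self-adjoint elements
  -- `star x * x`.
  have hstar : ∀ x, ((2⁻¹ : ℂ) • (ψ + star ψ)) (star x * x) = (g (star x * x) : ℂ) := fun x => by
    have h : (star ψ) (star x * x) = star (ψ (star x * x)) := by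
      rw [ArensBidual.star_apply]; simp
    rw [smul_apply, add_apply, h, ← hψre, smul_eq_mul, Complex.star_def,
      Complex.add_conj]
    push_cast
    ring
  have hkey : ∀ x, ‖f x‖ ^ 2 ≤ g (star x * x) := fun x => by
    have hph : ∃ w : ℂ, ‖w‖ = 1 ∧ w * f x = ‖f x‖ := by
      rcases eq_or_ne (f x) 0 with h | h
      · exact ⟨1, by simp, by simp [h]⟩
      · refine ⟨star (f x) / ‖f x‖, by simp [h], ?_⟩
        have h' : (‖f x‖ : ℂ) ≠ 0 := by simpa using h
        rw [div_mul_eq_mul_div, div_eq_iff h', Complex.star_def, Complex.conj_mul', sq]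
    obtain ⟨w, hw, hwf⟩ := hph
    -- Replacing `x` by `r w x`, with the phase `w` making `f` real, gives a quadratic in `r`; its
    -- discriminant recovers the bound on `‖f x‖²`.
    have hpoly : ∀ r : ℝ, 0 ≤ g (star x * x) * (r * r) + (-2 * ‖f x‖) * r + 1 := fun r => by
      have h1 := hfg (((r : ℂ) * w) • x)
      have h2 : star (((r : ℂ) * w) • x) * (((r : ℂ) * w) • x) = (r * r : ℝ) • (star x * x) := by
        have hw' : star w * w = 1 := by
          rw [Complex.star_def, Complex.conj_mul', hw]; simp
        rw [star_smul, smul_mul_smul_comm, ← Complex.coe_smul]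
        congr 1
        rw [star_mul', mul_mul_mul_comm, hw', mul_one, Complex.star_def, Complex.conj_ofReal]
        push_cast
        rfl
      rw [h2, map_smul, map_smul, smul_eq_mul, mul_assoc, hwf, smul_eq_mul, ← Complex.ofReal_mul,
        Complex.ofReal_re] at h1
      linarith
    have := discrim_le_zero hpoly
    rw [discrim] at this
    linarith
  refine ⟨(2⁻¹ : ℂ) • (ψ + star ψ), ?_, fun x => ?_, fun x => ?_⟩
  · refine (norm_smul_le (2⁻¹ : ℂ) (ψ + star ψ)).trans ?_
    have := (norm_add_le ψ (star ψ))
    rw [show ‖star ψ‖ = ‖ψ‖ from norm_star ψ] at this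
    norm_num
    linarith
  · rw [hstar]
    exact_mod_cast (sq_nonneg _).trans (hkey x)
  · rw [hstar, Complex.ofReal_re]
    exact hkey x

end Domination

universe u

/-! ### Functionals as GNS coefficients. -/

section GNS

open scoped InnerProductSpace

/-- The GNS construction for a positive functional `φ` on a C*-algebra: the functionals dominated
by `φ` are given by vectors in the GNS space. -/
theorem IsPositiveFunctional.exists_gns {X : Type u} [NonUnitalCStarAlgebra X]
    {φ : StrongDual ℂ X} (hφ : IsPositiveFunctional φ) :
    ∃ (H : Type u) (_ : NormedAddCommGroup H) (_ : InnerProductSpace ℂ H) (_ : CompleteSpace H)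
      (j : X →L[ℂ] H) (π : X →L[ℂ] H →L[ℂ] H),
      (∀ x y, ⟪j x, j y⟫_ℂ = φ (star x * y)) ∧ (∀ x y, j (x * y) = π x (j y)) ∧
      ∀ f : StrongDual ℂ X, (∀ x, ‖f x‖ ^ 2 ≤ (φ (star x * x)).re) →
        ∃ ζ : H, ‖ζ‖ ≤ 1 ∧ ∀ x, f x = ⟪ζ, j x⟫_ℂ := by
  let _ : PartialOrder X := CStarAlgebra.spectralOrder X
  have _ : StarOrderedRing X := CStarAlgebra.spectralOrderedRing X
  have hnn : ∀ x : X, 0 ≤ x → 0 ≤ φ x := fun x hx => by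
    obtain ⟨y, rfl⟩ := CStarAlgebra.nonneg_iff_eq_star_mul_self.mp hx
    exact hφ y
  let p : X →ₚ[ℂ] ℂ :=
    { φ.toLinearMap with
      monotone' := fun x y hxy => by
        have := hnn _ (sub_nonneg.mpr hxy)
        rw [map_sub] at this
        exact sub_nonneg.mp this }
  have hp : ∀ x, p x = φ x := fun _ => rfl
  have hnorm : ∀ x : X, ‖p.toPreGNS x‖ ^ 2 = (φ (star x * x)).re := fun x => by
    have := p.preGNS_norm_sq (p.toPreGNS x)
    rw [← Complex.ofReal_pow, p.ofPreGNS_toPreGNS, hp] at this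
    rw [← this, Complex.ofReal_re]
  let j₀ : X →L[ℂ] p.PreGNS := p.toPreGNS.toLinearMap.mkContinuous (√‖φ‖) fun x => by
    refine abs_le_of_sq_le_sq' ?_ (by positivity) |>.2
    rw [mul_pow, Real.sq_sqrt (norm_nonneg _)]
    refine (hnorm x).trans_le ((Complex.re_le_norm _).trans ((φ.le_opNorm _).trans_eq ?_))
    rw [CStarRing.norm_star_mul_self, sq]
  let j : X →L[ℂ] p.GNS := UniformSpace.Completion.toComplL ∘L j₀
  let π : X →L[ℂ] p.GNS →L[ℂ] p.GNS := LinearMap.mkContinuous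
    { toFun := p.gnsNonUnitalStarAlgHom
      map_add' := map_add _
      map_smul' := map_smul _ } 1 fun x => by
        rw [one_mul]
        exact NonUnitalStarAlgHom.norm_apply_le p.gnsNonUnitalStarAlgHom x
  refine ⟨p.GNS, inferInstance, inferInstance, inferInstance, j, π, fun x y => ?_, fun x y => ?_,
    fun f hf => ?_⟩
  · exact UniformSpace.Completion.inner_coe _ _
  · exact p.gnsNonUnitalStarAlgHom_apply_coe.symm
  -- Domination says that `f` is contractive for the GNS seminorm, so it extends to the completion
  -- and Riesz yields `ζ`.
  · let f₀ : p.PreGNS →L[ℂ] ℂ := (f.toLinearMap ∘ₗ p.ofPreGNS.toLinearMap).mkContinuous 1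
      fun x => by
        rw [one_mul]
        refine abs_le_of_sq_le_sq' ?_ (by positivity) |>.2
        exact (hf (p.ofPreGNS x)).trans_eq (hnorm (p.ofPreGNS x)).symm
    let f₁ : StrongDual ℂ p.GNS := f₀.extend UniformSpace.Completion.toComplL
    have hf₁ : ∀ x : p.PreGNS, f₁ x = f₀ x := fun x =>
      f₀.extend_eq (UniformSpace.Completion.denseRange_coe)
        (UniformSpace.Completion.isUniformInducing_coe _) x
    refine ⟨(InnerProductSpace.toDual ℂ p.GNS).symm f₁, ?_, fun x => ?_⟩
    · rw [LinearIsometryEquiv.norm_map]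
      refine f₁.opNorm_le_bound zero_le_one fun x => ?_
      induction x using UniformSpace.Completion.induction_on with
      | hp => exact isClosed_le (by fun_prop) (by fun_prop)
      | ih x =>
        rw [hf₁, UniformSpace.Completion.norm_coe]
        exact f₀.le_of_opNorm_le (LinearMap.mkContinuous_norm_le _ zero_le_one _) x
    · rw [InnerProductSpace.toDual_symm_apply]
      exact (hf₁ (p.toPreGNS x)).symm

/-- Every functional on a C*-algebra is a coefficient of the GNS representation of a contractive
positive functional. -/
theorem exists_gns_coefficient {X : Type u} [NonUnitalCStarAlgebra X] (f : StrongDual ℂ X) :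
    ∃ φ : StrongDual ℂ X, ‖φ‖ ≤ 1 ∧
      ∃ (H : Type u) (_ : NormedAddCommGroup H) (_ : InnerProductSpace ℂ H) (_ : CompleteSpace H)
        (j : X →L[ℂ] H) (π : X →L[ℂ] H →L[ℂ] H) (ζ : H),
        (∀ x y, ⟪j x, j y⟫_ℂ = φ (star x * y)) ∧ (∀ x y, j (x * y) = π x (j y)) ∧
        ‖ζ‖ ≤ ‖f‖ ∧ f = innerSL ℂ ζ ∘L j := by
  obtain ⟨φ, hφ1, hφ, hφf⟩ := exists_positive_dominating ((‖f‖⁻¹ : ℂ) • f) (by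
    rw [norm_smul, norm_inv, Complex.norm_real, norm_norm]
    exact inv_mul_le_one)
  obtain ⟨H, i₁, i₂, i₃, j, π, hj, hπ, hH⟩ := hφ.exists_gns
  obtain ⟨ζ, hζ, hfζ⟩ := hH _ hφf
  refine ⟨φ, hφ1, H, i₁, i₂, i₃, j, π, (‖f‖ : ℂ) • ζ, hj, hπ, ?_, ?_⟩
  · rw [norm_smul, Complex.norm_real, norm_norm]
    exact mul_le_of_le_one_right (norm_nonneg _) hζ
  · ext x
    rcases eq_or_ne f 0 with rfl | h
    · simp
    · have h' : (‖f‖ : ℂ) ≠ 0 := by simpa using h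
      have := hfζ x
      rw [smul_apply, smul_eq_mul, inv_mul_eq_iff_eq_mul₀ h'] at this
      simpa [inner_smul_left] using this

end GNS

/-! ### Arens regularity and the C*-structure of the bidual. -/

namespace ArensBidual

open scoped InnerProductSpace

section Vector

variable {X H : Type*} [NormedAddCommGroup X] [NormedSpace ℂ X] [NormedAddCommGroup H]
  [InnerProductSpace ℂ H] [CompleteSpace H]

/-- The second adjoint of a bounded linear map to a Hilbert space takes values in this Hilbert
space. -/
theorem exists_bidual_vector (j : X →L[ℂ] H) (Φ : StrongDual ℂ (StrongDual ℂ X)) :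
    ∃ η : H, ∀ l : StrongDual ℂ H, Φ (l ∘L j) = l η := by
  -- `h ↦ Φ ⟪h, j ·⟫` is conjugate-linear; conjugating its values makes Riesz applicable.
  let T : H →L⋆[ℂ] ℂ := (Φ ∘L ContinuousLinearMap.precomp ℂ j).comp (innerSL ℂ)
  let S : StrongDual ℂ H := (starL ℂ : ℂ ≃L⋆[ℂ] ℂ).toContinuousLinearMap.comp T
  refine ⟨(InnerProductSpace.toDual ℂ H).symm S, fun l => ?_⟩
  obtain ⟨h, rfl⟩ := (InnerProductSpace.toDual ℂ H).surjective l
  rw [InnerProductSpace.toDual_apply_apply, ← inner_conj_symm, InnerProductSpace.toDual_symm_apply]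
  exact (star_star (Φ (innerSL ℂ h ∘L j))).symm

end Vector

variable {X : Type*} [NonUnitalCStarAlgebra X]

/-- The functional `b ↦ Ψ (x ↦ f (x * b))`, which defines the second Arens product. -/
noncomputable def rightAct (Ψ : Bidual X) (f : StrongDual ℂ X) : StrongDual ℂ X :=
  Ψ ∘L (ContinuousLinearMap.compL ℂ X X ℂ f) ∘L (ContinuousLinearMap.mul ℂ X).flip

theorem rightAct_apply (Ψ : Bidual X) (f : StrongDual ℂ X) (b : X) :
    rightAct Ψ f b = Ψ (f ∘L (ContinuousLinearMap.mul ℂ X).flip b) := rfl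

/-- C*-algebras are Arens regular. -/
theorem mul_apply_eq_rightAct (Ψ Φ : Bidual X) (f : StrongDual ℂ X) :
    (Ψ * Φ) f = Φ (rightAct Ψ f) := by
  obtain ⟨φ, -, H, _, _, _, j, π, ζ, -, hπ, -, hf⟩ := exists_gns_coefficient f
  obtain ⟨η, hη⟩ := exists_bidual_vector j Φ
  -- `B h` is `x ↦ ⟪ζ, π x h⟫`, and `f (x * b) = B (j b) x`. Both Arens products therefore evaluate
  -- to `Ψ (B η)`.
  let B : H →L[ℂ] StrongDual ℂ X :=
    (ContinuousLinearMap.compL ℂ X H ℂ (innerSL ℂ ζ)) ∘L π.flip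
  have h1 : act Φ f = B η := by
    ext x
    rw [act_apply]
    have : f ∘L ContinuousLinearMap.mul ℂ X x = (innerSL ℂ ζ ∘L π x) ∘L j := by
      ext b
      rw [hf]
      simp [hπ]
    rw [this, hη]
    rfl
  have h2 : rightAct Ψ f = (Ψ ∘L B) ∘L j := by
    ext b
    rw [rightAct_apply]
    change _ = Ψ (B (j b))
    congr 1
    ext x
    rw [hf]
    simp [hπ, B]
  rw [mul_apply, h1, h2, hη]
  rfl

theorem rightAct_star (Ψ : Bidual X) (f : StrongDual ℂ X) :
    rightAct Ψ (star f) = star (act (star Ψ) f) := by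
  ext b
  rw [rightAct_apply, star_apply, act_apply, star_apply, star_star]
  congr 1
  ext x
  simp [star_apply]

/-- The involution exchanges the two Arens products, which agree by regularity. -/
theorem star_mul_bidual (Ψ Φ : Bidual X) : star (Ψ * Φ) = star Φ * star Ψ := by
  ext f
  rw [star_apply, mul_apply_eq_rightAct, rightAct_star, mul_apply, star_apply]

/-- In the GNS representation of `φ`, the value of `φ` at `Φ* Φ` is the squared norm of the vector
given by `Φ`. -/
theorem star_mul_self_apply {H : Type*} [NormedAddCommGroup H] [InnerProductSpace ℂ H]
    {φ : StrongDual ℂ X} {j : X →L[ℂ] H} (hj : ∀ x y, ⟪j x, j y⟫_ℂ = φ (star x * y))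
    {Φ : Bidual X} {η : H} (hη : ∀ l : StrongDual ℂ H, Φ (l ∘L j) = l η) :
    (star Φ * Φ) φ = (‖η‖ ^ 2 : ℝ) := by
  have h : star (act Φ φ) = innerSL ℂ η ∘L j := by
    ext x
    rw [star_apply, act_apply]
    have : φ ∘L ContinuousLinearMap.mul ℂ X (star x) = innerSL ℂ (j x) ∘L j := by
      ext b
      simp [hj]
    rw [this, hη]
    simp
  rw [mul_apply, star_apply, h, hη]
  simp [inner_self_eq_norm_sq_to_K]

/-- The value is the squared norm of a GNS vector. -/
theorem star_mul_self_apply_nonneg {φ : StrongDual ℂ X} (hφ : IsPositiveFunctional φ)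
    (Φ : Bidual X) : 0 ≤ (star Φ * Φ) φ := by
  obtain ⟨H, _, _, _, j, -, hj, -⟩ := hφ.exists_gns
  obtain ⟨η, hη⟩ := exists_bidual_vector j Φ
  rw [star_mul_self_apply hj hη]
  exact_mod_cast sq_nonneg ‖η‖

/-- With `Φ f = ⟪ζ, η⟫`, Cauchy–Schwarz applies: `‖ζ‖ ≤ ‖f‖`, while `‖η‖² = (Φ* Φ) φ ≤ ‖Φ* Φ‖`
because `‖φ‖ ≤ 1`. -/
theorem norm_mul_self_le_norm_star_mul_self (Φ : Bidual X) : ‖Φ‖ * ‖Φ‖ ≤ ‖star Φ * Φ‖ := by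
  have key : ‖Φ‖ ≤ √‖star Φ * Φ‖ := by
    refine Φ.opNorm_le_bound (Real.sqrt_nonneg _) fun f => ?_
    obtain ⟨φ, hφ, H, _, _, _, j, -, ζ, hj, -, hζ, hf⟩ := exists_gns_coefficient f
    obtain ⟨η, hη⟩ := exists_bidual_vector j Φ
    have hη' : ‖η‖ ≤ √‖star Φ * Φ‖ := by
      refine Real.le_sqrt_of_sq_le ?_
      have h := (star Φ * Φ).le_of_opNorm_le_of_le le_rfl hφ
      rw [star_mul_self_apply hj hη, mul_one, Complex.norm_real, Real.norm_of_nonneg (sq_nonneg _)]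
        at h
      exact h
    have h : Φ f = ⟪ζ, η⟫_ℂ := by rw [hf, hη]; rfl
    rw [h, mul_comm]
    exact (norm_inner_le_norm ζ η).trans (mul_le_mul hζ hη' (norm_nonneg _) (norm_nonneg _))
  rw [← sq]
  exact (Real.le_sqrt (norm_nonneg _) (norm_nonneg _)).mp key

variable (X) in
/-- The bidual of a C*-algebra is a C*-algebra. -/
@[reducible]
noncomputable def bidualCStarAlgebra : NonUnitalCStarAlgebra (Bidual X) where
  __ := (inferInstance : StarNormedAlgebra (Bidual X))
  __ := (inferInstance : CompleteSpace (Bidual X))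
  star_mul := star_mul_bidual
  norm_mul_self_le := norm_mul_self_le_norm_star_mul_self

end ArensBidual

/-! ### The adjoint of `ι_E`, and the transfer of states. -/

namespace ArensBidual

section Sub

variable {F : Type*} [NonUnitalCStarAlgebra F]

/-- A closed star-subalgebra of the bidual of a C*-algebra is a C*-algebra. -/
@[reducible]
noncomputable def subCStarAlgebra (E : NonUnitalStarSubalgebra ℂ (Bidual F))
    (hE : IsClosed (E : Set (Bidual F))) : NonUnitalCStarAlgebra E where
  __ := (inferInstance : StarNormedAlgebra E)
  star_mul x y := Subtype.ext (star_mul_bidual (x : Bidual F) y)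
  norm_mul_self_le x := norm_mul_self_le_norm_star_mul_self (x : Bidual F)
  complete := hE.completeSpace_coe.complete

variable (E : NonUnitalStarSubalgebra ℂ (Bidual F))

/-- The adjoint `E'' → F''` of the map `ι_E : F' → E'`. -/
noncomputable abbrev iotaAdjoint : Bidual E →L[ℂ] Bidual F :=
  ContinuousLinearMap.precomp ℂ (iota E)

variable {E}

theorem iotaAdjoint_apply (Θ : Bidual E) (f : StrongDual ℂ F) :
    iotaAdjoint E Θ f = Θ (iota E f) := rfl

/-- The product of `E` is that of `F''`. Regularity of `F''` lets `(e * b) f` be read as `b` applied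
to a functional on `F`, so that `Ψ` acts on it through `ι_E`. -/
theorem iotaAdjoint_mul (Θ Ψ : Bidual E) :
    iotaAdjoint E (Θ * Ψ) = iotaAdjoint E Θ * iotaAdjoint E Ψ := by
  ext f
  rw [iotaAdjoint_apply, mul_apply, mul_apply, iotaAdjoint_apply]
  congr 1
  ext e
  rw [act_apply, iota_apply, ← mul_apply, mul_apply_eq_rightAct, iotaAdjoint_apply]
  congr 1
  ext b
  exact mul_apply_eq_rightAct (e : Bidual F) b f

theorem iotaAdjoint_star (Θ : Bidual E) : iotaAdjoint E (star Θ) = star (iotaAdjoint E Θ) := by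
  ext f
  rw [iotaAdjoint_apply, star_apply, star_apply, iotaAdjoint_apply]
  congr 2
  ext e
  rw [star_apply, iota_apply, iota_apply]
  exact (star_star ((e : Bidual F) (star f))).symm.trans
    (congrArg star (star_apply (e : Bidual F) f).symm) |>.symm

/-- The adjoint of `ι_E` as a star-isomorphism. -/
noncomputable def iotaAdjointEquiv (h : (iota E).IsInvertible) : Bidual E ≃⋆ₐ[ℂ] Bidual F :=
  { Equiv.ofBijective (iotaAdjoint E) (by
      obtain ⟨e, he⟩ := h
      constructor
      · intro Θ Ψ hΘ
        ext m
        obtain ⟨f, rfl⟩ := e.surjective m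
        have := congr($hΘ f)
        rwa [iotaAdjoint_apply, iotaAdjoint_apply, ← he] at this
      · intro Φ
        refine ⟨Φ ∘L (e.symm : StrongDual ℂ E →L[ℂ] StrongDual ℂ F), ?_⟩
        ext f
        rw [iotaAdjoint_apply, ← he]
        simp) with
    map_mul' := iotaAdjoint_mul
    map_add' := map_add (iotaAdjoint E)
    map_star' := iotaAdjoint_star
    map_smul' := map_smul (iotaAdjoint E) }

/-- A star-isomorphism of C*-algebras is isometric; the bidual construction is applied to `E` as
well as to `F`. -/
theorem isometry_iotaAdjointEquiv (hE : IsClosed (E : Set (Bidual F)))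
    (h : (iota E).IsInvertible) : Isometry (iotaAdjointEquiv h) :=
  @StarAlgEquiv.isometry _ _ _ (@bidualCStarAlgebra E (subCStarAlgebra E hE)) (bidualCStarAlgebra F)
    _ _ _ (iotaAdjointEquiv h)

theorem isometry_iota (hE : IsClosed (E : Set (Bidual F))) (h : (iota E).IsInvertible) :
    Isometry (iota E) := by
  refine AddMonoidHomClass.isometry_of_norm _ fun f => le_antisymm ?_ ?_
  · refine ContinuousLinearMap.opNorm_le_bound _ (norm_nonneg _) fun e => ?_
    rw [iota_apply, mul_comm]
    exact (e : Bidual F).le_opNorm f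
  -- A norming element for `f` lifts isometrically to `E''`, where it tests the norm of `ι_E f`.
  · obtain ⟨Φ, hΦ, hΦf⟩ := exists_dual_vector'' ℂ f
    obtain ⟨Θ, rfl⟩ := EquivLike.surjective (iotaAdjointEquiv h) Φ
    have hΘ : ‖Θ‖ ≤ 1 := by
      rwa [(isometry_iotaAdjointEquiv hE h).norm_map_of_map_zero (map_zero _)] at hΦ
    have h1 : Θ (iota E f) = ‖f‖ := hΦf
    have h2 := Θ.le_of_opNorm_le hΘ (iota E f)
    rwa [h1, Complex.norm_real, norm_norm, one_mul] at h2

theorem inclusionInDoubleDual_star_mul (x : F) (f : StrongDual ℂ F) :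
    (star (NormedSpace.inclusionInDoubleDual ℂ F x) * NormedSpace.inclusionInDoubleDual ℂ F x) f =
      f (star x * x) := by
  rw [mul_apply, star_apply, NormedSpace.dual_def, star_apply, star_star, act_apply,
    NormedSpace.dual_def]
  rfl

/-- Each direction evaluates a positive functional on a bidual: `E` sits inside `F''`, and `F`
inside `F'' ≅ E''`. -/
theorem isPositiveFunctional_iota_iff (hE : IsClosed (E : Set (Bidual F)))
    (h : (iota E).IsInvertible) (f : StrongDual ℂ F) :
    IsPositiveFunctional (iota E f) ↔ IsPositiveFunctional f := by
  refine ⟨fun hf x => ?_, fun hf e => ?_⟩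
  · rw [← inclusionInDoubleDual_star_mul]
    obtain ⟨Θ, hΘ⟩ := EquivLike.surjective (iotaAdjointEquiv h)
      (NormedSpace.inclusionInDoubleDual ℂ F x)
    have hΘ' : iotaAdjoint E Θ = NormedSpace.inclusionInDoubleDual ℂ F x := hΘ
    rw [← hΘ', ← iotaAdjoint_star, ← iotaAdjoint_mul]
    exact @star_mul_self_apply_nonneg E (subCStarAlgebra E hE) _ hf Θ
  · exact star_mul_self_apply_nonneg hf (e : Bidual F)

theorem image_stateSpace_iota (hE : IsClosed (E : Set (Bidual F))) (h : (iota E).IsInvertible) :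
    iota E '' stateSpace F = stateSpace E := by
  have key : ∀ f, iota E f ∈ stateSpace E ↔ f ∈ stateSpace F := fun f => by
    rw [stateSpace, stateSpace, Set.mem_ofPred_eq, Set.mem_ofPred_eq,
      isPositiveFunctional_iota_iff hE h,
      (isometry_iota hE h).norm_map_of_map_zero (map_zero _)]
  refine Set.Subset.antisymm (Set.image_subset_iff.mpr fun f hf => (key f).mpr hf) fun m hm => ?_
  obtain ⟨f, rfl⟩ := h.bijective.surjective m
  exact ⟨f, (key f).mp hm, rfl⟩

end Sub

end ArensBidual

open ArensBidual in
theorem proposition2p2 {F : Type*} [NonUnitalCStarAlgebra F]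
    (mul : StrongDual ℂ F →L[ℂ] StrongDual ℂ F →L[ℂ] StrongDual ℂ F)
    (hmul : IsBanachAlgebraMul mul)
    (E : NonUnitalStarSubalgebra ℂ (Bidual F))
    (hE : IsPredual mul E) :
    (∃ φ : Bidual E ≃⋆ₐ[ℂ] Bidual F,
      (∀ x, φ x = ContinuousLinearMap.precomp ℂ (iota E) x) ∧ Isometry φ) ∧
    IsIsometricPredual mul E ∧
    ∀ m : StrongDual ℂ E,
      (IsPositiveFunctional (X := F) ((iota E).inverse m) ↔ IsPositiveFunctional (X := E) m) ∧
      (IsStateFunctional (X := F) ((iota E).inverse m) ↔ IsStateFunctional (X := E) m) ∧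
      (IsPureStateFunctional (X := F) ((iota E).inverse m) ↔ IsPureStateFunctional (X := E) m) := by
  have hc := hE.isClosed
  have hi := hE.isInvertible
  refine ⟨⟨iotaAdjointEquiv hi, fun _ => rfl, isometry_iotaAdjointEquiv hc hi⟩,
    ⟨hE, isometry_iota hc hi⟩, fun m => ?_⟩
  have hinj : Function.Injective (iota E) := hi.bijective.injective
  obtain ⟨f, rfl⟩ := hi.bijective.surjective m
  have hf : (iota E).inverse (iota E f) = f := by
    obtain ⟨e, he⟩ := hi
    rw [← he, ContinuousLinearMap.inverse_equiv]
    exact e.symm_apply_apply f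
  rw [hf]
  refine ⟨(isPositiveFunctional_iota_iff hc hi f).symm, ?_, ?_⟩
  · rw [IsStateFunctional, IsStateFunctional, ← image_stateSpace_iota hc hi,
      hinj.mem_set_image]
  · rw [IsPureStateFunctional, IsPureStateFunctional, ← image_stateSpace_iota hc hi]
    -- Extreme points use real segments, so the linear bijection is needed only over `ℝ`.
    let L : StrongDual ℂ F ≃ₗ[ℝ] StrongDual ℂ E :=
      (LinearEquiv.ofBijective (iota E).toLinearMap hi.bijective).restrictScalars ℝ
    have := image_extremePoints L (stateSpace F)
    change iota E '' _ = (iota E '' _).extremePoints ℝ at this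
    rw [← this, hinj.mem_set_image]
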